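/- For a topological space $Y$ let $\mathcal F(Y)$ be the set of all nonempty closed subsets of $Y$ with the Vietoris topology, i.e. the topology generated by the sets $\{F: F\subseteq V\}$ and $\{F: F\cap V\neq\emptyset\}$, where $V$ runs over the open subsets of $Y$. There exists a mapping $f:\mathbb R\to\mathcal F(\mathbb R)$ with the following properties. (1) $f$ is Baire-one: it is the pointwise limit of a sequence of continuous mappings $\mathbb R\to\mathcal F(\mathbb R)$. (2) $f$ is $F_\sigma$-measurable: $f^{-1}(V)$ is an $F_\sigma$-set in $\mathbb R$ for every open $V\subseteq\mathcal F(\mathbb R)$. (3) $f$ is Darboux: $f(I)$ is connected for every connected $I\subseteq\mathbb R$. (4) The restriction $f|_C$ of $f$ to the (ternary) Cantor set $C\subseteq\mathbb R$ is discontinuous at every point of $C$; hence $f$ is not barely continuous, i.e. it is not true that for every nonempty closed $F\subseteq\mathbb R$ the restriction $f|_F$ has a point of continuity. (5) The subspace $f(\mathbb R)$ of $\mathcal F(\mathbb R)$ is hereditarily Lindelöf; moreover it is perfectly normal (that is, $T_1$, normal, and with every closed set a $G_\delta$-set). -/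

import Mathlib

open Set Filter Topology

/-- The hyperspace `𝓕(Y)` of all nonempty closed subsets of a topological space `Y`. -/
structure NonemptyClosedSubsets (Y : Type*) [TopologicalSpace Y] where
  /-- the underlying set -/
  carrier : Set Y
  isClosed : IsClosed carrier
  nonempty : carrier.Nonempty

/-- The Vietoris topology on `𝓕(Y)`. -/
instance (Y : Type*) [TopologicalSpace Y] : TopologicalSpace (NonemptyClosedSubsets Y) :=
  TopologicalSpace.induced NonemptyClosedSubsets.carrier (TopologicalSpace.vietoris Y)

/-- The topology on `𝓕(Y)` is generated by the sets `{F | F ⊆ V}` and `{F | F ∩ V ≠ ∅}`,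
with `V` open in `Y`. -/
theorem NonemptyClosedSubsets.topology_eq_generateFrom (Y : Type*) [TopologicalSpace Y] :
    (inferInstance : TopologicalSpace (NonemptyClosedSubsets Y)) =
      TopologicalSpace.generateFrom
        ({W | ∃ V : Set Y, IsOpen V ∧ W = {F | F.carrier ⊆ V}} ∪
          {W | ∃ V : Set Y, IsOpen V ∧ W = {F | (F.carrier ∩ V).Nonempty}}) := by
  change TopologicalSpace.induced _ (TopologicalSpace.vietoris Y) = _
  rw [TopologicalSpace.vietoris, induced_generateFrom_eq]
  congr 1
  ext W
  simp only [image_union, mem_union, mem_image, mem_ofPred_eq]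
  constructor
  · rintro (⟨_, ⟨V, hV, rfl⟩, rfl⟩ | ⟨_, ⟨V, hV, rfl⟩, rfl⟩)
    · exact Or.inl ⟨V, hV, rfl⟩
    · exact Or.inr ⟨V, hV, rfl⟩
  · rintro (⟨V, hV, rfl⟩ | ⟨V, hV, rfl⟩)
    · exact Or.inl ⟨_, ⟨V, hV, rfl⟩, rfl⟩
    · exact Or.inr ⟨_, ⟨V, hV, rfl⟩, rfl⟩

/-- An `F_σ`-set: a countable union of closed sets. -/
def IsFSigma {X : Type*} [TopologicalSpace X] (s : Set X) : Prop :=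
  ∃ F : ℕ → Set X, (∀ n, IsClosed (F n)) ∧ s = ⋃ n, F n

/-- `f` is `F_σ`-measurable: preimages of open sets are `F_σ`-sets. -/
def FSigmaMeasurable {X Y : Type*} [TopologicalSpace X] [TopologicalSpace Y] (f : X → Y) : Prop :=
  ∀ V : Set Y, IsOpen V → IsFSigma (f ⁻¹' V)

/-- `f` is Baire-one: a pointwise limit of a sequence of continuous mappings `X → Y`. -/
def IsBaireOne {X Y : Type*} [TopologicalSpace X] [TopologicalSpace Y] (f : X → Y) : Prop :=
  ∃ g : ℕ → X → Y, (∀ n, Continuous (g n)) ∧ ∀ x, Tendsto (fun n => g n x) atTop (𝓝 (f x))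

/-- `f` is Darboux: images of connected sets are connected. -/
def IsDarboux {X Y : Type*} [TopologicalSpace X] [TopologicalSpace Y] (f : X → Y) : Prop :=
  ∀ C : Set X, IsConnected C → IsConnected (f '' C)

/-- `f` is barely continuous: its restriction to every nonempty closed subspace has a
continuity point. -/
def BarelyContinuous {X Y : Type*} [TopologicalSpace X] [TopologicalSpace Y] (f : X → Y) : Prop :=
  ∀ F : Set X, IsClosed F → F.Nonempty → ∃ x : F, ContinuousAt (F.domRestrict f) x

/-!
Only this matters about the Cantor set `C`: it is nonempty and perfect, and its complement is dense.
Let `a 0, a 1, …` enumerate the points of `C` that are isolated from the right in `C`, and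
let `g` be a lower semicontinuous function with `g (a i) ≤ i`, equal to `⊤` at the other points of
`C`, and finite and continuous off `C`. The map is `x ↦ ⋃ i, [2 i, 2 i + min 1 (c i x)]`, where
`c i x` is the excess of `g x` over `i` if `a i < x`, and `0` otherwise.

Each `c i` is lower semicontinuous, hence an increasing limit of Lipschitz functions, which makes
the map Baire-one. The map is left continuous off the countable set of the `a i`, hence it is
`F_σ`-measurable with hereditarily Lindelöf range; a regular hereditarily Lindelöf space is
perfectly normal. An `F_σ`-measurable map on an interval whose value at every point is a cluster
value from both sides is Darboux, by the Baire category theorem. Finally, arbitrarily close to each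
`x ∈ C` there are points of `C` where some `c i` equals `⊤` while `c i x = 0`. The index `i` may
grow as these points approach `x`, so every coordinate may converge, but the Vietoris topology
controls all the intervals uniformly: the map is discontinuous at `x` along `C`.
-/

open scoped ENNReal
open Metric

namespace NonemptyClosedSubsets

variable {Y : Type*} [TopologicalSpace Y]

theorem isOpen_setOf_subset {V : Set Y} (hV : IsOpen V) :
    IsOpen {F : NonemptyClosedSubsets Y | F.carrier ⊆ V} :=
  isOpen_induced (t := TopologicalSpace.vietoris Y) hV.powerset_vietoris

theorem isOpen_setOf_inter_nonempty {V : Set Y} (hV : IsOpen V) :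
    IsOpen {F : NonemptyClosedSubsets Y | (F.carrier ∩ V).Nonempty} :=
  isOpen_induced (t := TopologicalSpace.vietoris Y)
    (TopologicalSpace.vietoris.isOpen_inter_nonempty_of_isOpen hV)

theorem isClosed_setOf_subset {K : Set Y} (hK : IsClosed K) :
    IsClosed {F : NonemptyClosedSubsets Y | F.carrier ⊆ K} :=
  @IsClosed.preimage _ _ _ (TopologicalSpace.vietoris Y) _ continuous_induced_dom _
    hK.powerset_vietoris

theorem isClosed_setOf_inter_nonempty {K : Set Y} (hK : IsClosed K) :
    IsClosed {F : NonemptyClosedSubsets Y | (F.carrier ∩ K).Nonempty} :=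
  @IsClosed.preimage _ _ _ (TopologicalSpace.vietoris Y) _ continuous_induced_dom _
    (TopologicalSpace.vietoris.isClosed_inter_nonempty_of_isClosed hK)

theorem tendsto_nhds_iff {ι : Type*} {l : Filter ι} {u : ι → NonemptyClosedSubsets Y}
    {F : NonemptyClosedSubsets Y} :
    Tendsto u l (𝓝 F) ↔
      (∀ V, IsOpen V → F.carrier ⊆ V → ∀ᶠ i in l, (u i).carrier ⊆ V) ∧
      (∀ V, IsOpen V → (F.carrier ∩ V).Nonempty → ∀ᶠ i in l, ((u i).carrier ∩ V).Nonempty) := by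
  constructor
  · exact fun h => ⟨fun V hV hF => h ((isOpen_setOf_subset hV).mem_nhds hF),
      fun V hV hF => h ((isOpen_setOf_inter_nonempty hV).mem_nhds hF)⟩
  · rintro ⟨h_subset, h_inter⟩
    have nhds_eq : 𝓝 F = @nhds _ (TopologicalSpace.generateFrom _) F :=
      congrArg (fun t => @nhds _ t F) (topology_eq_generateFrom Y)
    rw [nhds_eq, TopologicalSpace.tendsto_nhds_generateFrom_iff]
    rintro _ (⟨V, hV, rfl⟩ | ⟨V, hV, rfl⟩) hF
    · exact h_subset V hV hF
    · exact h_inter V hV hF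

theorem carrier_subset_of_specializes {F G : NonemptyClosedSubsets Y} (h : F ⤳ G) :
    G.carrier ⊆ F.carrier := by
  have := @Specializes.map _ _ _ (TopologicalSpace.vietoris Y) _ _ _ h continuous_induced_dom
  simpa only [F.isClosed.closure_eq] using
    TopologicalSpace.vietoris.subset_closure_of_specializes this

instance : T0Space (NonemptyClosedSubsets Y) where
  t0 F G h := by
    have := (carrier_subset_of_specializes h.specializes').antisymm
      (carrier_subset_of_specializes h.specializes)
    cases F; cases G; congr

section Regular

variable {F : NonemptyClosedSubsets Y} {V : Set Y}

theorem exists_isClosed_mem_nhds_forall_subset [NormalSpace Y] (hV : IsOpen V)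
    (hF : F.carrier ⊆ V) : ∃ T ∈ 𝓝 F, IsClosed T ∧ ∀ G ∈ T, G.carrier ⊆ V := by
  obtain ⟨W, hW, hFW, hWV⟩ := normal_exists_closure_subset F.isClosed hV hF
  exact ⟨{G | G.carrier ⊆ closure W}, mem_of_superset ((isOpen_setOf_subset hW).mem_nhds hFW)
    fun G (hG : G.carrier ⊆ W) => hG.trans subset_closure,
    isClosed_setOf_subset isClosed_closure, fun G hG => hG.trans hWV⟩

theorem exists_isClosed_mem_nhds_forall_inter_nonempty [RegularSpace Y] (hV : IsOpen V)
    (hF : (F.carrier ∩ V).Nonempty) :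
    ∃ T ∈ 𝓝 F, IsClosed T ∧ ∀ G ∈ T, (G.carrier ∩ V).Nonempty := by
  obtain ⟨y, hyF, hyV⟩ := hF
  obtain ⟨K, hKy, hK, hKV⟩ := exists_mem_nhds_isClosed_subset (hV.mem_nhds hyV)
  refine ⟨{G | (G.carrier ∩ K).Nonempty},
    mem_of_superset ((isOpen_setOf_inter_nonempty isOpen_interior).mem_nhds
      ⟨y, hyF, mem_interior_iff_mem_nhds.2 hKy⟩) fun G hG => ?_,
    isClosed_setOf_inter_nonempty hK, fun G hG => hG.mono (inter_subset_inter_right _ hKV)⟩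
  exact Nonempty.mono (inter_subset_inter_right _ interior_subset) hG

instance [NormalSpace Y] [R0Space Y] : RegularSpace (NonemptyClosedSubsets Y) := by
  refine RegularSpace.of_lift'_closure_le fun F => ?_
  have mem_lift_closure : ∀ {S T : Set (NonemptyClosedSubsets Y)}, T ∈ 𝓝 F → IsClosed T → T ⊆ S →
      S ∈ (𝓝 F).lift' closure := fun hT hTc hTS =>
    mem_of_superset (mem_lift' hT) ((closure_minimal Subset.rfl hTc).trans hTS)
  refine tendsto_id'.1 (tendsto_nhds_iff.2 ⟨fun V hV hF => ?_, fun V hV hF => ?_⟩)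
  · obtain ⟨T, hT, hTc, hTV⟩ := exists_isClosed_mem_nhds_forall_subset hV hF
    exact mem_lift_closure hT hTc hTV
  · obtain ⟨T, hT, hTc, hTV⟩ := exists_isClosed_mem_nhds_forall_inter_nonempty hV hF
    exact mem_lift_closure hT hTc hTV

end Regular

end NonemptyClosedSubsets

theorem isGδ_of_isClosed_of_hereditarilyLindelofSpace {X : Type*} [TopologicalSpace X]
    [RegularSpace X] [HereditarilyLindelofSpace X] {K : Set X} (hK : IsClosed K) : IsGδ K := by
  choose t ht htc htK using fun x : ↥Kᶜ =>
    exists_mem_nhds_isClosed_subset (hK.isOpen_compl.mem_nhds x.2)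
  obtain ⟨T, hT, hTU⟩ := eq_open_union_countable (fun x => interior (t x)) fun _ => isOpen_interior
  have hKT : K = ⋂ x ∈ T, (t x)ᶜ := by
    refine Subset.antisymm (subset_iInter₂ fun x _ => subset_compl_comm.1 (htK x)) ?_
    rw [← compl_subset_compl, compl_iInter₂]
    intro x hx
    have : x ∈ ⋃ y ∈ T, interior (t y) :=
      hTU ▸ mem_iUnion.2 ⟨⟨x, hx⟩, mem_interior_iff_mem_nhds.2 (ht ⟨x, hx⟩)⟩
    simpa only [compl_compl] using iUnion₂_mono (fun _ _ => interior_subset) this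
  rw [hKT]
  exact .biInter hT fun x _ => (htc x).isOpen_compl.isGδ

theorem t6Space_of_regularSpace_of_hereditarilyLindelofSpace (X : Type*) [TopologicalSpace X]
    [T0Space X] [RegularSpace X] [HereditarilyLindelofSpace X] : T6Space X where
  closed_gdelta _ := isGδ_of_isClosed_of_hereditarilyLindelofSpace

theorem isFSigma_iff_isGδ_compl {X : Type*} [TopologicalSpace X] {s : Set X} :
    IsFSigma s ↔ IsGδ sᶜ := by
  rw [isGδ_iff_eq_iInter_nat]
  constructor
  · rintro ⟨F, hF, rfl⟩
    exact ⟨fun n => (F n)ᶜ, fun n => (hF n).isOpen_compl, compl_iUnion F⟩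
  · rintro ⟨U, hU, hs⟩
    exact ⟨fun n => (U n)ᶜ, fun n => (hU n).isClosed_compl,
      by rw [← compl_iInter, ← hs, compl_compl]⟩

theorem interior_mem_nhdsLT {α : Type*} [LinearOrder α] [TopologicalSpace α] [ClosedIciTopology α]
    {x : α} {s : Set α} (hs : s ∈ 𝓝[<] x) : interior s ∈ 𝓝[<] x := by
  obtain ⟨O, hO, hxO, hOs⟩ := mem_nhdsWithin.1 hs
  exact mem_nhdsWithin.2 ⟨O, hO, hxO, interior_maximal hOs (hO.inter isOpen_Iio)⟩

section LeftContinuous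

variable {α Y : Type*} [LinearOrder α] [TopologicalSpace α] [OrderTopology α]
  [SecondCountableTopology α] {A : Set α}

theorem countable_iUnion_diff_iUnion_interior {ι : Type*} {W : ι → Set α}
    (hA : A.Countable) (hW : ∀ i, ∀ x ∈ W i, x ∉ A → W i ∈ 𝓝[<] x) :
    ((⋃ i, W i) \ ⋃ i, interior (W i)).Countable := by
  set N := (⋃ i, W i) \ ⋃ i, interior (W i)
  refine (hA.union (countable_setOfPred_isolated_left_within (s := N))).mono fun x hx => ?_
  refine or_iff_not_imp_left.2 fun hxA => ⟨hx, ?_⟩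
  obtain ⟨i, hi⟩ := mem_iUnion.1 hx.1
  rw [inter_comm, nhdsWithin_inter', inf_principal_eq_bot]
  filter_upwards [interior_mem_nhdsLT (hW i x hi hxA)] with y hy hyN
  exact hyN.2 (mem_iUnion.2 ⟨i, hy⟩)

theorem exists_countable_biUnion_eq_iUnion {ι : Type*} {W : ι → Set α}
    (hA : A.Countable) (hW : ∀ i, ∀ x ∈ W i, x ∉ A → W i ∈ 𝓝[<] x) :
    ∃ T : Set ι, T.Countable ∧ ⋃ i ∈ T, W i = ⋃ i, W i := by
  have hN := countable_iUnion_diff_iUnion_interior hA hW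
  obtain ⟨T, hT, hTU⟩ := TopologicalSpace.isOpen_iUnion_countable
    (fun i => interior (W i)) fun i => isOpen_interior
  choose j hj using fun x : ↥((⋃ i, W i) \ ⋃ i, interior (W i)) => mem_iUnion.1 x.2.1
  have := hN.to_subtype
  refine ⟨T ∪ range j, hT.union (countable_range j),
    (iUnion₂_subset_iUnion _ _).antisymm fun x hx => ?_⟩
  by_cases hxU : x ∈ ⋃ i, interior (W i)
  · rw [← hTU] at hxU
    exact biUnion_mono subset_union_left (fun _ _ => interior_subset) hxU
  · exact mem_biUnion (Or.inr (mem_range_self ⟨x, hx, hxU⟩)) (hj _)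

variable [TopologicalSpace Y] {f : α → Y}

theorem FSigmaMeasurable.of_tendsto_nhdsLT (hA : A.Countable)
    (hf : ∀ x ∉ A, Tendsto f (𝓝[<] x) (𝓝 (f x))) : FSigmaMeasurable f := by
  intro V hV
  have hN := countable_iUnion_diff_iUnion_interior (W := fun _ : Unit => f ⁻¹' V) hA
    fun _ x hx hxA => hf x hxA (hV.mem_nhds hx)
  simp only [iUnion_const] at hN
  have hcompl : (f ⁻¹' V)ᶜ = (interior (f ⁻¹' V))ᶜ ∩ (f ⁻¹' V \ interior (f ⁻¹' V))ᶜ := by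
    rw [← compl_union, union_sdiff_cancel interior_subset]
  rw [isFSigma_iff_isGδ_compl, hcompl]
  exact (isGδ_of_isClosed_of_hereditarilyLindelofSpace isOpen_interior.isClosed_compl).inter
    hN.isGδ_compl

theorem hereditarilyLindelofSpace_range_of_tendsto_nhdsLT (hA : A.Countable)
    (hf : ∀ x ∉ A, Tendsto f (𝓝[<] x) (𝓝 (f x))) : HereditarilyLindelofSpace (range f) := by
  have hf' : ∀ x ∉ A, Tendsto (rangeFactorization f) (𝓝[<] x) (𝓝 (rangeFactorization f x)) :=
    fun x hx => tendsto_subtype_rng.2 (hf x hx)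
  refine .of_forall_isOpen fun s _ => isLindelof_of_countable_subcover fun U hU hsU => ?_
  obtain ⟨T, hT, hTU⟩ := exists_countable_biUnion_eq_iUnion
    (W := fun i => rangeFactorization f ⁻¹' U i) hA fun i x hx hxA => hf' x hxA ((hU i).mem_nhds hx)
  simp only [← preimage_iUnion] at hTU
  exact ⟨T, hT, rangeFactorization_surjective.preimage_injective hTU ▸ hsU⟩

end LeftContinuous

section Darboux

theorem exists_isOpen_inter_subset_of_subset_iUnion {X ι : Type*} [TopologicalSpace X]
    [Countable ι] {K : Set X} [BaireSpace K] (hK : K.Nonempty) {F : ι → Set X}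
    (hF : ∀ i, IsClosed (F i)) (hKF : K ⊆ ⋃ i, F i) :
    ∃ i, ∃ O : Set X, IsOpen O ∧ (O ∩ K).Nonempty ∧ O ∩ K ⊆ F i := by
  have := hK.to_subtype
  have hcover : ⋃ i, ((↑) : K → X) ⁻¹' F i = univ := by
    rwa [← preimage_iUnion, preimage_eq_univ_iff, Subtype.range_coe]
  obtain ⟨i, z, hz⟩ := nonempty_interior_of_iUnion_of_closed
    (fun i => (hF i).preimage continuous_subtype_val) hcover
  obtain ⟨_, hOF, ⟨O, hO, rfl⟩, hzO⟩ := mem_interior.1 hz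
  exact ⟨i, O, hO, ⟨z, hzO, z.2⟩, fun x hx => hOF (show (⟨x, hx.2⟩ : K) ∈ _ from hx.1)⟩

theorem IsFSigma.exists_isOpen_inter_subset_or {X : Type*} [TopologicalSpace X] {A B K : Set X}
    [BaireSpace K] (hA : IsFSigma A) (hB : IsFSigma B) (hK : K.Nonempty) (hKAB : K ⊆ A ∪ B) :
    ∃ O : Set X, IsOpen O ∧ (O ∩ K).Nonempty ∧ (O ∩ K ⊆ A ∨ O ∩ K ⊆ B) := by
  obtain ⟨F, hF, rfl⟩ := hA
  obtain ⟨G, hG, rfl⟩ := hB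
  obtain ⟨i | i, O, hO, hne, hsub⟩ := exists_isOpen_inter_subset_of_subset_iUnion
    (F := Sum.elim F G) hK (Sum.rec hF hG) (by rwa [iUnion_sum])
  · exact ⟨O, hO, hne, Or.inl (subset_iUnion_of_subset i hsub)⟩
  · exact ⟨O, hO, hne, Or.inr (subset_iUnion_of_subset i hsub)⟩

section LinearOrder

variable {α : Type*} [LinearOrder α] [TopologicalSpace α]

/-- Every point of `A` is both a left and a right accumulation point of `A`. -/
def IsBilaterallyDenseInItself (A : Set α) : Prop :=
  ∀ x ∈ A, (∃ᶠ y in 𝓝[<] x, y ∈ A) ∧ ∃ᶠ y in 𝓝[>] x, y ∈ A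

theorem isBilaterallyDenseInItself_preimage {Y : Type*} [TopologicalSpace Y] {f : α → Y}
    (hl : ∀ x, MapClusterPt (f x) (𝓝[<] x) f) (hr : ∀ x, MapClusterPt (f x) (𝓝[>] x) f)
    {U : Set Y} (hU : IsOpen U) :
    IsBilaterallyDenseInItself (f ⁻¹' U) := fun x hx =>
  ⟨(hl x).frequently (hU.mem_nhds hx), (hr x).frequently (hU.mem_nhds hx)⟩

variable [OrderTopology α] [CompactIccSpace α] {A B G : Set α} {z q : α}

theorem exists_mem_Icc_closure_diff_of_frequently_nhdsGT
    (hA : ∀ x ∈ A, ∃ᶠ y in 𝓝[>] x, y ∈ A) (hzq : z ≤ q) (hz : z ∈ closure A)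
    (hq : q ∉ closure A) : ∃ s ∈ Icc z q, s ∈ closure A \ A := by
  obtain ⟨s, ⟨hs, hsA⟩, hmax⟩ := (isCompact_Icc.inter_right isClosed_closure).exists_isGreatest
    ⟨z, left_mem_Icc.2 hzq, hz⟩
  refine ⟨s, hs, hsA, fun hs' => ?_⟩
  have hsq : s < q := hs.2.lt_of_ne (ne_of_mem_of_not_mem hsA hq)
  obtain ⟨y, hyA, hsy, hyq⟩ := ((hA s hs').and_eventually (Ioo_mem_nhdsGT hsq)).exists
  exact hsy.not_ge (hmax ⟨⟨hs.1.trans hsy.le, hyq.le⟩, subset_closure hyA⟩)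

theorem IsBilaterallyDenseInItself.exists_mem_uIcc_closure_diff
    (hA : IsBilaterallyDenseInItself A) (hz : z ∈ closure A) (hq : q ∉ closure A) :
    ∃ s ∈ uIcc z q, s ∈ closure A \ A := by
  rcases le_total z q with h | h
  · rw [uIcc_of_le h]
    exact exists_mem_Icc_closure_diff_of_frequently_nhdsGT (fun x hx => (hA x hx).2) h hz hq
  · obtain ⟨s, hs, hsA⟩ := exists_mem_Icc_closure_diff_of_frequently_nhdsGT (α := αᵒᵈ)
      (fun x hx => (hA x hx).1) h hz hq
    exact ⟨s, uIcc_of_ge h ▸ hs.symm, hsA⟩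

theorem IsBilaterallyDenseInItself.inter_closure_inter_closure_eq_empty
    (hA : IsBilaterallyDenseInItself A) (hG : IsOpen G) (hGAB : G ⊆ A ∪ B)
    (hdisj : G ∩ (A ∩ B) = ∅) (hsub : G ∩ (closure A ∩ closure B) ⊆ A) :
    G ∩ (closure A ∩ closure B) = ∅ := by
  refine eq_empty_of_forall_notMem fun z ⟨hzG, hzA, hzB⟩ => ?_
  obtain ⟨q, hzq, hqB⟩ := mem_closure_iff_nhds.1 hzB _
    (ordConnectedComponent_mem_nhds.2 (hG.mem_nhds hzG))
  have hqG : q ∈ G := hzq right_mem_uIcc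
  have hqA : q ∉ closure A := fun h =>
    hdisj.subset ⟨hqG, hsub ⟨hqG, h, subset_closure hqB⟩, hqB⟩
  obtain ⟨s, hs, hsA, hsA'⟩ := hA.exists_mem_uIcc_closure_diff hzA hqA
  have hsB : s ∈ B := (hGAB (hzq hs)).resolve_left hsA'
  exact hsA' (hsub ⟨hzq hs, hsA, subset_closure hsB⟩)

theorem IsBilaterallyDenseInItself.inter_nonempty_of_isPreconnected [LocallyCompactSpace α]
    {J : Set α} (hJ : IsOpen J) (hJc : IsPreconnected J)
    (hA : IsBilaterallyDenseInItself A) (hAσ : IsFSigma A)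
    (hB : IsBilaterallyDenseInItself B) (hBσ : IsFSigma B)
    (hJAB : J ⊆ A ∪ B) (hJA : (J ∩ A).Nonempty) (hJB : (J ∩ B).Nonempty) :
    (J ∩ (A ∩ B)).Nonempty := by
  by_contra! hdisj
  have hK : (J ∩ (closure A ∩ closure B)).Nonempty :=
    isPreconnected_closed_iff.1 hJc _ _ isClosed_closure isClosed_closure
      (hJAB.trans (union_subset_union subset_closure subset_closure))
      (hJA.mono (inter_subset_inter_right _ subset_closure))
      (hJB.mono (inter_subset_inter_right _ subset_closure))
  have := (hJ.isLocallyClosed.inter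
    (isClosed_closure.inter isClosed_closure).isLocallyClosed :
      IsLocallyClosed (J ∩ (closure A ∩ closure B))).locallyCompactSpace
  obtain ⟨O, hO, hne, hsub⟩ := hAσ.exists_isOpen_inter_subset_or hBσ hK
    (inter_subset_left.trans hJAB)
  rw [← inter_assoc] at hne hsub
  have hOJ : O ∩ J ⊆ A ∪ B := inter_subset_right.trans hJAB
  have hOdisj : O ∩ J ∩ (A ∩ B) = ∅ := by rw [inter_assoc, hdisj, inter_empty]
  rcases hsub with hsub | hsub
  · exact hne.ne_empty (hA.inter_closure_inter_closure_eq_empty (hO.inter hJ) hOJ hOdisj hsub)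
  · rw [inter_comm (closure A)] at hne hsub
    rw [inter_comm A] at hOdisj
    rw [union_comm] at hOJ
    exact hne.ne_empty (hB.inter_closure_inter_closure_eq_empty (hO.inter hJ) hOJ hOdisj hsub)

end LinearOrder

variable {α Y : Type*} [ConditionallyCompleteLinearOrder α] [TopologicalSpace α] [OrderTopology α]
  [DenselyOrdered α] [LocallyCompactSpace α] [TopologicalSpace Y] {f : α → Y} {a b : α}

theorem FSigmaMeasurable.isPreconnected_image_Ioo (hf : FSigmaMeasurable f)
    (hl : ∀ x, MapClusterPt (f x) (𝓝[<] x) f) (hr : ∀ x, MapClusterPt (f x) (𝓝[>] x) f) :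
    IsPreconnected (f '' Ioo a b) := by
  intro U V hU hV hUV hfU hfV
  rw [image_subset_iff] at hUV
  rw [image_inter_nonempty_iff] at hfU hfV ⊢
  exact IsBilaterallyDenseInItself.inter_nonempty_of_isPreconnected isOpen_Ioo isPreconnected_Ioo
    (isBilaterallyDenseInItself_preimage hl hr hU) (hf U hU)
    (isBilaterallyDenseInItself_preimage hl hr hV) (hf V hV) hUV hfU hfV

theorem FSigmaMeasurable.isPreconnected_image_Icc (hf : FSigmaMeasurable f)
    (hl : ∀ x, MapClusterPt (f x) (𝓝[<] x) f) (hr : ∀ x, MapClusterPt (f x) (𝓝[>] x) f)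
    (hab : a < b) : IsPreconnected (f '' Icc a b) := by
  refine (hf.isPreconnected_image_Ioo hl hr).subset_closure (image_mono Ioo_subset_Icc_self) ?_
  have mem_closure : ∀ {x : α} {l : Filter α}, MapClusterPt (f x) l f → Ioo a b ∈ l →
      f x ∈ closure (f '' Ioo a b) := fun h hmem =>
    clusterPt_iff_forall_mem_closure.1 h _ (image_mem_map hmem)
  rintro _ ⟨x, hx, rfl⟩
  obtain rfl | rfl | hx := eq_endpoints_or_mem_Ioo_of_mem_Icc hx
  · exact mem_closure (hr x) (Ioo_mem_nhdsGT hab)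
  · exact mem_closure (hl x) (Ioo_mem_nhdsLT hab)
  · exact subset_closure (mem_image_of_mem f hx)

theorem FSigmaMeasurable.isDarboux (hf : FSigmaMeasurable f)
    (hl : ∀ x, MapClusterPt (f x) (𝓝[<] x) f) (hr : ∀ x, MapClusterPt (f x) (𝓝[>] x) f) :
    IsDarboux f := by
  refine fun C hC => ⟨hC.nonempty.image f, isPreconnected_of_forall_pair ?_⟩
  rintro _ ⟨x, hx, rfl⟩ _ ⟨y, hy, rfl⟩
  wlog hxy : x ≤ y generalizing x y
  · obtain ⟨t, htC, hty, htx, ht⟩ := this y hy x hx (le_of_not_ge hxy)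
    exact ⟨t, htC, htx, hty, ht⟩
  refine ⟨f '' Icc x y, image_mono (hC.isPreconnected.Icc_subset hx hy),
    mem_image_of_mem f (left_mem_Icc.2 hxy), mem_image_of_mem f (right_mem_Icc.2 hxy), ?_⟩
  rcases hxy.eq_or_lt with rfl | hlt
  · simpa only [Icc_self, image_singleton] using isPreconnected_singleton
  · exact hf.isPreconnected_image_Icc hl hr hlt

end Darboux

section LipschitzRegularization

variable {X : Type*} [PseudoEMetricSpace X]

/-- The `n`-Lipschitz regularization of an extended nonnegative function: its inf-convolution with
`n * edist`. -/
noncomputable def lipschitzRegularization (h : X → ℝ≥0∞) (n : ℕ) (x : X) : ℝ≥0∞ :=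
  ⨅ y, h y + n * edist x y

theorem continuous_lipschitzRegularization (h : X → ℝ≥0∞) (n : ℕ) :
    Continuous (lipschitzRegularization h n) := by
  refine continuous_of_le_add_edist n (ENNReal.natCast_ne_top n) fun x y => ?_
  rw [lipschitzRegularization, lipschitzRegularization, ENNReal.iInf_add]
  refine le_iInf fun z => (iInf_le _ z).trans ?_
  rw [add_assoc, ← mul_add, add_comm (edist y z)]
  gcongr
  exact edist_triangle x y z

theorem lipschitzRegularization_le (h : X → ℝ≥0∞) (n : ℕ) (x : X) :
    lipschitzRegularization h n x ≤ h x :=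
  (iInf_le _ x).trans (by simp)

theorem tendsto_lipschitzRegularization {h : X → ℝ≥0∞} {x : X}
    (hh : LowerSemicontinuousAt h x) :
    Tendsto (fun n => lipschitzRegularization h n x) atTop (𝓝 (h x)) := by
  refine tendsto_order.2 ⟨fun c hc => ?_, fun c hc =>
    Eventually.of_forall fun n => (lipschitzRegularization_le h n x).trans_lt hc⟩
  obtain ⟨c', hcc', hc'⟩ := exists_between hc
  obtain ⟨ε, hε, hball⟩ := EMetric.mem_nhds_iff.1 (hh c' hc')
  obtain ⟨n, hn⟩ := ENNReal.exists_nat_mul_gt hε.ne' hc'.ne_top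
  filter_upwards [eventually_ge_atTop n] with m hm
  refine hcc'.trans_le (le_iInf fun y => ?_)
  by_cases hy : edist y x < ε
  · exact (hball hy).le.trans le_self_add
  · calc c' ≤ n * ε := hn.le
      _ ≤ m * edist x y := by
        rw [edist_comm]
        gcongr
        exact not_lt.1 hy
      _ ≤ h y + m * edist x y := le_add_self

end LipschitzRegularization

/-- The number `min 1 c`, as an element of `[0, 1]`. -/
noncomputable def unitTrunc (c : ℝ≥0∞) : ℝ := (min 1 c).toReal

theorem min_one_ne_top (c : ℝ≥0∞) : min 1 c ≠ ⊤ := (min_lt_of_left_lt ENNReal.one_lt_top).ne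

theorem continuous_unitTrunc : Continuous unitTrunc :=
  ENNReal.continuousOn_toReal.comp_continuous (continuous_const.min continuous_id) min_one_ne_top

theorem monotone_unitTrunc : Monotone unitTrunc := fun _ b h =>
  ENNReal.toReal_mono (min_one_ne_top b) (min_le_min_left _ h)

theorem unitTrunc_nonneg (c : ℝ≥0∞) : 0 ≤ unitTrunc c := ENNReal.toReal_nonneg

theorem unitTrunc_le_one (c : ℝ≥0∞) : unitTrunc c ≤ 1 :=
  ENNReal.toReal_mono ENNReal.one_ne_top (min_le_left _ _)

theorem one_le_unitTrunc_iff {c : ℝ≥0∞} : 1 ≤ unitTrunc c ↔ 1 ≤ c := by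
  rw [unitTrunc, ← ENNReal.toReal_one, ENNReal.toReal_le_toReal ENNReal.one_ne_top
    (min_one_ne_top c), le_min_iff, and_iff_right le_rfl]

/-- The closed set `⋃ i, [2 i, 2 i + min 1 (c i)]`. -/
noncomputable def intervalUnion (c : ℕ → ℝ≥0∞) : NonemptyClosedSubsets ℝ where
  carrier := ⋃ i : ℕ, Icc (2 * i : ℝ) (2 * i + unitTrunc (c i))
  isClosed := by
    refine LocallyFinite.isClosed_iUnion (fun x => ⟨Iio (x + 1), Iio_mem_nhds (lt_add_one x), ?_⟩)
      fun i => isClosed_Icc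
    refine (finite_Iio ⌈x + 1⌉₊).subset ?_
    rintro i ⟨y, ⟨hy, -⟩, hyx⟩
    refine Nat.lt_ceil.2 (lt_of_le_of_lt ?_ (hy.trans_lt hyx))
    linarith [i.cast_nonneg (α := ℝ)]
  nonempty := ⟨0, mem_iUnion.2 ⟨0, by simpa using unitTrunc_nonneg (c 0)⟩⟩

theorem mem_intervalUnion {c : ℕ → ℝ≥0∞} {y : ℝ} :
    y ∈ (intervalUnion c).carrier ↔ ∃ i : ℕ, y ∈ Icc (2 * i : ℝ) (2 * i + unitTrunc (c i)) :=
  mem_iUnion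

theorem two_mul_add_one_mem_intervalUnion {c : ℕ → ℝ≥0∞} {i : ℕ} :
    (2 * i + 1 : ℝ) ∈ (intervalUnion c).carrier ↔ 1 ≤ c i := by
  rw [mem_intervalUnion, ← one_le_unitTrunc_iff]
  constructor
  · rintro ⟨j, hj, hj'⟩
    have hle : 2 * j ≤ 2 * i + 1 := by exact_mod_cast hj
    have hge : 2 * i + 1 ≤ 2 * j + 1 := by
      exact_mod_cast hj'.trans (add_le_add_right (unitTrunc_le_one (c j)) _)
    obtain rfl : i = j := by omega
    linarith
  · exact fun h => ⟨i, by linarith, by linarith⟩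

section Tendsto

variable {ι : Type*} {l : Filter ι} {c : ι → ℕ → ℝ≥0∞} {d : ℕ → ℝ≥0∞} {V : Set ℝ}

theorem eventually_Icc_two_mul_subset {i : ℕ} (h : Tendsto (fun k => c k i) l (𝓝 (d i)))
    (hV : IsOpen V) (hdV : Icc (2 * i : ℝ) (2 * i + unitTrunc (d i)) ⊆ V) :
    ∀ᶠ k in l, Icc (2 * i : ℝ) (2 * i + unitTrunc (c k i)) ⊆ V := by
  have hmem : (2 * i : ℝ) + unitTrunc (d i) ∈ V :=
    hdV ⟨le_add_of_nonneg_right (unitTrunc_nonneg _), le_rfl⟩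
  obtain ⟨u, v, huv, hsub⟩ := mem_nhds_iff_exists_Ioo_subset.1 (hV.mem_nhds hmem)
  have hlim := ((continuous_unitTrunc.tendsto _).comp h).const_add (2 * i : ℝ)
  filter_upwards [hlim.eventually_lt_const huv.2] with k hk y hy
  rcases le_or_gt y (2 * i + unitTrunc (d i)) with hyd | hyd
  · exact hdV ⟨hy.1, hyd⟩
  · exact hsub ⟨huv.1.trans hyd, hy.2.trans_lt hk⟩

theorem eventually_intervalUnion_subset (h : ∀ i, Tendsto (fun k => c k i) l (𝓝 (d i))) {N : ℕ}
    (hN : ∀ᶠ k in l, ∀ i ≥ N, c k i ≤ d i) (hV : IsOpen V)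
    (hdV : (intervalUnion d).carrier ⊆ V) :
    ∀ᶠ k in l, (intervalUnion (c k)).carrier ⊆ V := by
  have hfin : ∀ᶠ k in l, ∀ i ∈ Finset.range N,
      Icc (2 * i : ℝ) (2 * i + unitTrunc (c k i)) ⊆ V :=
    (Finset.eventually_all _).2 fun i _ =>
      eventually_Icc_two_mul_subset (h i) hV ((subset_iUnion _ i).trans hdV)
  filter_upwards [hfin, hN] with k hk hkN y hy
  obtain ⟨i, hi⟩ := mem_intervalUnion.1 hy
  rcases lt_or_ge i N with hiN | hiN
  · exact hk i (Finset.mem_range.2 hiN) hi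
  · exact hdV (mem_intervalUnion.2 ⟨i, hi.1,
      hi.2.trans (add_le_add_right (monotone_unitTrunc (hkN i hiN)) _)⟩)

theorem eventually_intervalUnion_inter_nonempty (h : ∀ i, Tendsto (fun k => c k i) l (𝓝 (d i)))
    (hV : IsOpen V) (hdV : ((intervalUnion d).carrier ∩ V).Nonempty) :
    ∀ᶠ k in l, ((intervalUnion (c k)).carrier ∩ V).Nonempty := by
  obtain ⟨y, hy, hyV⟩ := hdV
  obtain ⟨i, hi, hi'⟩ := mem_intervalUnion.1 hy
  have hlim : Tendsto (fun k => min y (2 * i + unitTrunc (c k i))) l (𝓝 y) := by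
    simpa only [Function.comp_apply, min_eq_left hi'] using (tendsto_const_nhds (x := y)).min
      (((continuous_unitTrunc.tendsto _).comp (h i)).const_add (2 * i : ℝ))
  filter_upwards [hlim (hV.mem_nhds hyV)] with k hk
  exact ⟨_, mem_intervalUnion.2 ⟨i, le_min hi (le_add_of_nonneg_right (unitTrunc_nonneg _)),
    min_le_right _ _⟩, hk⟩

theorem tendsto_intervalUnion (h : ∀ i, Tendsto (fun k => c k i) l (𝓝 (d i))) {N : ℕ}
    (hN : ∀ᶠ k in l, ∀ i ≥ N, c k i ≤ d i) :
    Tendsto (fun k => intervalUnion (c k)) l (𝓝 (intervalUnion d)) :=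
  NonemptyClosedSubsets.tendsto_nhds_iff.2
    ⟨fun _ hV => eventually_intervalUnion_subset h hN hV,
      fun _ hV => eventually_intervalUnion_inter_nonempty h hV⟩

end Tendsto

theorem isBaireOne_intervalUnion {X : Type*} [PseudoEMetricSpace X] {h : ℕ → X → ℝ≥0∞}
    (hh : ∀ i, LowerSemicontinuous (h i)) :
    IsBaireOne fun x => intervalUnion fun i => h i x := by
  refine ⟨fun n x => intervalUnion fun i =>
    if i < n then lipschitzRegularization (h i) n x else 0, fun n => ?_, fun x => ?_⟩
  · refine continuous_iff_continuousAt.2 fun x =>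
      tendsto_intervalUnion (N := n) (fun i => ?_) (Eventually.of_forall fun y i hi => ?_)
    · split_ifs
      · exact (continuous_lipschitzRegularization (h i) n).continuousAt
      · exact tendsto_const_nhds
    · simp [not_lt.2 hi]
  · refine tendsto_intervalUnion (N := 0) (fun i => ?_) (Eventually.of_forall fun n i _ => ?_)
    · refine (tendsto_lipschitzRegularization (hh i x)).congr' ?_
      filter_upwards [eventually_gt_atTop i] with n hn
      rw [if_pos hn]
    · split_ifs
      · exact lipschitzRegularization_le _ _ _
      · exact zero_le

theorem not_tendsto_intervalUnion {ι : Type*} {l : Filter ι} {c : ι → ℕ → ℝ≥0∞} {d : ℕ → ℝ≥0∞}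
    (h : ∃ᶠ k in l, ∃ i, d i < 1 ∧ 1 ≤ c k i) :
    ¬ Tendsto (fun k => intervalUnion (c k)) l (𝓝 (intervalUnion d)) := by
  intro hlim
  set E : Set ℤ := {m | ∃ i : ℕ, d i < 1 ∧ m = 2 * i + 1}
  have hE : IsClosed ((↑) '' E : Set ℝ) :=
    Int.isClosedEmbedding_coe_real.isClosedMap _ (isClosed_discrete E)
  have hdE : (intervalUnion d).carrier ⊆ ((↑) '' E : Set ℝ)ᶜ := by
    rintro _ hy ⟨_, ⟨i, hi, rfl⟩, rfl⟩
    push_cast at hy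
    exact hi.not_ge (two_mul_add_one_mem_intervalUnion.1 hy)
  obtain ⟨k, ⟨i, hdi, hci⟩, hk⟩ := (h.and_eventually
    ((NonemptyClosedSubsets.tendsto_nhds_iff.1 hlim).1 _ hE.isOpen_compl hdE)).exists
  exact hk (two_mul_add_one_mem_intervalUnion.2 hci) ⟨2 * i + 1, ⟨i, hdi, rfl⟩, by push_cast; rfl⟩

theorem mapClusterPt_of_frequently {X Y : Type*} [TopologicalSpace Y] {f : X → Y} {y : Y}
    {l : Filter X} {s : Set X} (hs : ∃ᶠ x in l, x ∈ s) (h : Tendsto f (l ⊓ 𝓟 s) (𝓝 y)) :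
    MapClusterPt y l f :=
  have : NeBot (l ⊓ 𝓟 s) := frequently_mem_iff_neBot.1 hs
  h.mapClusterPt.mono inf_le_left

section Staircase

variable {X : Type*} [LinearOrder X] {a : ℕ → X} {g : X → ℝ≥0∞} {x : X}

/-- The `i`-th coordinate of the staircase map: it vanishes up to the `i`-th node `a i`, and is the
excess of the potential `g` over `i` beyond it. -/
noncomputable def staircaseCoord (a : ℕ → X) (g : X → ℝ≥0∞) (i : ℕ) (x : X) : ℝ≥0∞ :=
  if a i < x then g x - i else 0

/-- The map into the hyperspace of `ℝ` with nodes `a` and potential `g`. It is continuous where the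
potential is continuous and finite, and left continuous where the potential is infinite. -/
noncomputable def staircaseMap (a : ℕ → X) (g : X → ℝ≥0∞) (x : X) : NonemptyClosedSubsets ℝ :=
  intervalUnion fun i => staircaseCoord a g i x

theorem staircaseCoord_of_lt {i : ℕ} (h : a i < x) : staircaseCoord a g i x = g x - i := if_pos h

theorem staircaseCoord_of_le {i : ℕ} (h : x ≤ a i) : staircaseCoord a g i x = 0 := if_neg h.not_gt

theorem staircaseCoord_le_sub (i : ℕ) : staircaseCoord a g i x ≤ g x - i := by
  rcases lt_or_ge (a i) x with h | h
  · exact (staircaseCoord_of_lt h).le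
  · exact (staircaseCoord_of_le h).trans_le zero_le

theorem staircaseCoord_eq_zero_of_le {i : ℕ} (h : g x ≤ i) : staircaseCoord a g i x = 0 :=
  le_zero_iff.1 ((staircaseCoord_le_sub i).trans_eq (tsub_eq_zero_of_le h))

theorem staircaseCoord_eq_top {i : ℕ} (hx : g x = ⊤) (h : a i < x) :
    staircaseCoord a g i x = ⊤ := by
  rw [staircaseCoord_of_lt h, hx, ENNReal.top_sub (ENNReal.natCast_ne_top i)]

theorem staircaseCoord_le_of_le {y : X} (hx : g x = ⊤) (hyx : y ≤ x) (i : ℕ) :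
    staircaseCoord a g i y ≤ staircaseCoord a g i x := by
  rcases lt_or_ge (a i) y with h | h
  · exact le_top.trans_eq (staircaseCoord_eq_top hx (h.trans_le hyx)).symm
  · exact (staircaseCoord_of_le h).trans_le zero_le

theorem exists_mem_Ioo_forall_staircaseCoord_le {v : X} (hga : ∀ i, g (a i) ≤ i) (hx : g x = ⊤)
    (h : ∃ k, a k ∈ Ioo x v) :
    ∃ y ∈ Ioo x v, ∀ i, staircaseCoord a g i y ≤ staircaseCoord a g i x := by
  classical
  -- The node of least index in `Ioo x v`: earlier nodes to its left are already to the left of `x`.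
  set k := Nat.find h
  have hk : a k ∈ Ioo x v := Nat.find_spec h
  refine ⟨a k, hk, fun i => ?_⟩
  rcases le_or_gt k i with hki | hik
  · rw [staircaseCoord_eq_zero_of_le ((hga k).trans (Nat.cast_le.2 hki))]
    exact zero_le
  rcases lt_trichotomy (a i) x with hix | hix | hix
  · exact le_top.trans_eq (staircaseCoord_eq_top hx hix).symm
  · exact absurd hx ((hix ▸ hga i).trans_lt (ENNReal.natCast_lt_top i)).ne
  · have hki : a k ≤ a i := not_lt.1 fun hlt => Nat.find_min h hik ⟨hix, hlt.trans hk.2⟩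
    exact (staircaseCoord_of_le hki).trans_le zero_le

theorem not_tendsto_staircaseMap {l : Filter X}
    (h : ∃ᶠ y in l, g y = ⊤ ∧ ∃ i, a i < y ∧ (x ≤ a i ∨ g x ≤ i)) :
    ¬ Tendsto (staircaseMap a g) l (𝓝 (staircaseMap a g x)) := by
  refine not_tendsto_intervalUnion (h.mono ?_)
  rintro y ⟨hy, i, hiy, hi⟩
  have hx : staircaseCoord a g i x = 0 :=
    hi.elim staircaseCoord_of_le staircaseCoord_eq_zero_of_le
  exact ⟨i, hx.trans_lt one_pos, le_top.trans_eq (staircaseCoord_eq_top hy hiy).symm⟩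

variable [TopologicalSpace X] [OrderTopology X]

theorem lowerSemicontinuous_staircaseCoord (hg : LowerSemicontinuous g) (i : ℕ) :
    LowerSemicontinuous (staircaseCoord a g i) := by
  intro x c hc
  have hix : a i < x := not_le.1 fun h => not_lt_zero (hc.trans_eq (staircaseCoord_of_le h))
  rw [staircaseCoord_of_lt hix, gt_iff_lt, lt_tsub_iff_right] at hc
  filter_upwards [lt_mem_nhds hix, hg x _ hc] with y hiy hy
  rwa [staircaseCoord_of_lt hiy, gt_iff_lt, lt_tsub_iff_right]

theorem tendsto_staircaseCoord {l : Filter X} (hga : ∀ i, g (a i) ≤ i) (hl : l ≤ 𝓝 x)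
    (hg : Tendsto g l (𝓝 (g x))) (i : ℕ) :
    Tendsto (staircaseCoord a g i) l (𝓝 (staircaseCoord a g i x)) := by
  have hsub : Tendsto (fun y => g y - i) l (𝓝 (g x - i)) :=
    ((ENNReal.continuous_sub_right i).tendsto _).comp hg
  rcases lt_trichotomy (a i) x with h | rfl | h
  · rw [staircaseCoord_of_lt h]
    exact hsub.congr'
      (((lt_mem_nhds h).filter_mono hl).mono fun y hy => (staircaseCoord_of_lt hy).symm)
  · rw [tsub_eq_zero_of_le (hga i)] at hsub
    rw [staircaseCoord_of_le le_rfl]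
    exact tendsto_of_tendsto_of_tendsto_of_le_of_le tendsto_const_nhds hsub (fun _ => zero_le)
      fun y => staircaseCoord_le_sub i
  · rw [staircaseCoord_of_le h.le]
    exact tendsto_const_nhds.congr'
      (((gt_mem_nhds h).filter_mono hl).mono fun y hy => (staircaseCoord_of_le (le_of_lt hy)).symm)

theorem tendsto_staircaseMap_of_ne_top {l : Filter X} (hga : ∀ i, g (a i) ≤ i) (hl : l ≤ 𝓝 x)
    (hg : Tendsto g l (𝓝 (g x))) (hx : g x ≠ ⊤) :
    Tendsto (staircaseMap a g) l (𝓝 (staircaseMap a g x)) := by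
  obtain ⟨N, hN⟩ := ENNReal.exists_nat_gt hx
  refine tendsto_intervalUnion (N := N) (tendsto_staircaseCoord hga hl hg) ?_
  filter_upwards [hg.eventually_lt_const hN] with y hy i hi
  rw [staircaseCoord_eq_zero_of_le (hy.le.trans (Nat.cast_le.2 hi))]
  exact zero_le

theorem tendsto_staircaseMap_of_eq_top {l : Filter X} (hga : ∀ i, g (a i) ≤ i)
    (hg : LowerSemicontinuous g) (hl : l ≤ 𝓝 x) (hx : g x = ⊤)
    (h : ∀ᶠ y in l, ∀ i, staircaseCoord a g i y ≤ staircaseCoord a g i x) :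
    Tendsto (staircaseMap a g) l (𝓝 (staircaseMap a g x)) := by
  have hlim : Tendsto g l (𝓝 (g x)) := tendsto_order.2
    ⟨fun c hc => hl (hg x c hc), fun c hc => absurd hc (hx ▸ not_top_lt)⟩
  exact tendsto_intervalUnion (N := 0) (tendsto_staircaseCoord hga hl hlim)
    (h.mono fun y hy i _ => hy i)

theorem tendsto_staircaseMap_nhdsLT (hga : ∀ i, g (a i) ≤ i) (hg : LowerSemicontinuous g)
    (hx : g x = ⊤) : Tendsto (staircaseMap a g) (𝓝[<] x) (𝓝 (staircaseMap a g x)) := by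
  refine tendsto_staircaseMap_of_eq_top hga hg nhdsWithin_le_nhds hx ?_
  filter_upwards [self_mem_nhdsWithin] with y hy
  exact staircaseCoord_le_of_le hx (le_of_lt hy)

theorem mapClusterPt_staircaseMap_nhdsGT [NoMaxOrder X] (hga : ∀ i, g (a i) ≤ i)
    (hg : LowerSemicontinuous g) (hx : g x = ⊤) (h : ∃ᶠ y in 𝓝[>] x, y ∈ range a) :
    MapClusterPt (staircaseMap a g x) (𝓝[>] x) (staircaseMap a g) := by
  have hfreq : ∃ᶠ y in 𝓝[>] x, ∀ i, staircaseCoord a g i y ≤ staircaseCoord a g i x := by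
    refine frequently_iff.2 fun {U} hU => ?_
    obtain ⟨v, hv, hvU⟩ := mem_nhdsGT_iff_exists_Ioo_subset.1 hU
    obtain ⟨_, ⟨k, rfl⟩, hk⟩ := (h.and_eventually (Ioo_mem_nhdsGT hv)).exists
    obtain ⟨y, hy, hyx⟩ := exists_mem_Ioo_forall_staircaseCoord_le hga hx ⟨k, hk⟩
    exact ⟨y, hvU hy, hyx⟩
  exact mapClusterPt_of_frequently hfreq (tendsto_staircaseMap_of_eq_top hga hg
    (inf_le_left.trans nhdsWithin_le_nhds) hx (mem_inf_of_right (mem_principal_self _)))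

end Staircase

section GapPotential

theorem lowerSemicontinuous_iInf_natCast_add {X : Type*} [TopologicalSpace X]
    {h : ℕ → X → ℝ≥0∞} (hh : ∀ k, LowerSemicontinuous (h k)) :
    LowerSemicontinuous fun x => ⨅ k : ℕ, k + h k x := by
  intro x c hc
  obtain ⟨c', hcc', hc'⟩ := exists_between hc
  obtain ⟨M, hM⟩ := ENNReal.exists_nat_gt hc'.ne_top
  have hfin : ∀ᶠ y in 𝓝 x, ∀ k ∈ Finset.range M, c' < k + h k y :=
    (Finset.eventually_all _).2 fun k _ =>
      (lowerSemicontinuous_const.add (hh k)) x c' (hc'.trans_le (iInf_le _ k))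
  filter_upwards [hfin] with y hy
  refine hcc'.trans_le (le_iInf fun k => ?_)
  rcases lt_or_ge k M with hk | hk
  · exact (hy k (Finset.mem_range.2 hk)).le
  · exact hM.le.trans ((Nat.cast_le.2 hk).trans le_self_add)

variable {X : Type*} [PseudoMetricSpace X] {x : X}

section DistRatio

variable {S C : Set X}

/-- The ratio of the distances to `S` and to `C`. The junk value `0 / 0 = 0` at the points of
`S ∩ C` is the intended one. -/
noncomputable def distRatio (S C : Set X) (x : X) : ℝ≥0∞ := infEDist x S / infEDist x C

theorem distRatio_of_mem (hx : x ∈ S) : distRatio S C x = 0 := by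
  rw [distRatio, infEDist_zero_of_mem hx, ENNReal.zero_div]

theorem distRatio_eq_top (hS : IsClosed S) (hxS : x ∉ S) (hxC : x ∈ C) : distRatio S C x = ⊤ := by
  rw [distRatio, infEDist_zero_of_mem hxC]
  exact ENNReal.div_zero (mt (mem_iff_infEDist_zero_of_closed hS).2 hxS)

theorem distRatio_ne_top (hS : S.Nonempty) (hC : IsClosed C) (hx : x ∉ C) :
    distRatio S C x ≠ ⊤ :=
  (ENNReal.div_lt_top (infEDist_ne_top hS) (mt (mem_iff_infEDist_zero_of_closed hC).2 hx)).ne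

theorem continuousAt_distRatio (hS : S.Nonempty) (h : x ∉ closure S ∨ x ∉ closure C) :
    ContinuousAt (distRatio S C) x :=
  ENNReal.Tendsto.div continuous_infEDist.continuousAt
    (h.imp (mt mem_closure_iff_infEDist_zero.2) (mt mem_closure_iff_infEDist_zero.2))
    continuous_infEDist.continuousAt (Or.inr (infEDist_ne_top hS))

theorem lowerSemicontinuous_distRatio (hS : IsClosed S) (hne : S.Nonempty) :
    LowerSemicontinuous (distRatio S C) := by
  intro x
  by_cases hx : x ∈ S
  · exact fun c hc => absurd hc ((distRatio_of_mem hx).trans_le zero_le).not_gt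
  · exact (continuousAt_distRatio hne
      (Or.inl (hS.closure_eq.symm ▸ hx))).lowerSemicontinuousAt

end DistRatio

variable {C : Set X} {S : ℕ → Set X}

/-- A function which, on the set `C`, is the least index `k` with `x ∈ S k` (and `⊤` if there is
none), extended to the whole space by means of the distances. -/
noncomputable def gapPotential (C : Set X) (S : ℕ → Set X) (x : X) : ℝ≥0∞ :=
  ⨅ k : ℕ, k + distRatio (S k) C x

theorem lowerSemicontinuous_gapPotential (hS : ∀ k, IsClosed (S k)) (hne : ∀ k, (S k).Nonempty) :
    LowerSemicontinuous (gapPotential C S) :=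
  lowerSemicontinuous_iInf_natCast_add fun k => lowerSemicontinuous_distRatio (hS k) (hne k)

theorem gapPotential_le_natCast {k : ℕ} (hx : x ∈ S k) : gapPotential C S x ≤ k :=
  (iInf_le _ k).trans_eq (by rw [distRatio_of_mem hx, add_zero])

theorem gapPotential_eq_top (hS : ∀ k, IsClosed (S k)) (hxC : x ∈ C) (hx : ∀ k, x ∉ S k) :
    gapPotential C S x = ⊤ :=
  iInf_eq_top.2 fun k => by rw [distRatio_eq_top (hS k) (hx k) hxC, add_top]

theorem gapPotential_ne_top (hne : ∀ k, (S k).Nonempty) (hC : IsClosed C) (hx : x ∉ C) :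
    gapPotential C S x ≠ ⊤ :=
  ne_top_of_le_ne_top
    (ENNReal.add_ne_top.2 ⟨ENNReal.natCast_ne_top 0, distRatio_ne_top (hne 0) hC hx⟩) (iInf_le _ 0)

theorem continuousAt_gapPotential (hS : ∀ k, IsClosed (S k)) (hne : ∀ k, (S k).Nonempty)
    (hC : IsClosed C) (hx : x ∉ C) : ContinuousAt (gapPotential C S) x :=
  continuousAt_iff_lower_upperSemicontinuousAt.2
    ⟨lowerSemicontinuous_gapPotential hS hne x, upperSemicontinuousAt_iInf fun k =>
      (continuousAt_const.add (continuousAt_distRatio (hne k)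
        (Or.inr (hC.closure_eq.symm ▸ hx)))).upperSemicontinuousAt⟩

theorem gapPotential_le_of_forall_mem {y : X} (hS : ∀ k, IsClosed (S k)) (hx : x ∈ C)
    (hy : ∀ k, x ∈ S k → y ∈ S k) : gapPotential C S y ≤ gapPotential C S x := by
  refine iInf_mono fun k => ?_
  by_cases hxk : x ∈ S k
  · rw [distRatio_of_mem (hy k hxk), distRatio_of_mem hxk]
  · rw [distRatio_eq_top (hS k) hxk hx, add_top]
    exact le_top

theorem tendsto_gapPotential {l : Filter X} (hS : ∀ k, IsClosed (S k))
    (hne : ∀ k, (S k).Nonempty) (hx : x ∈ C) (hl : l ≤ 𝓝 x)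
    (h : ∀ᶠ y in l, ∀ k, x ∈ S k → y ∈ S k) :
    Tendsto (gapPotential C S) l (𝓝 (gapPotential C S x)) :=
  tendsto_order.2 ⟨fun c hc => hl (lowerSemicontinuous_gapPotential hS hne x c hc),
    fun _ hc => h.mono fun _ hy => (gapPotential_le_of_forall_mem hS hx hy).trans_lt hc⟩

end GapPotential

section ApproachSet

theorem exists_isClosed_subset_insert_frequently_mem {X : Type*} [TopologicalSpace X]
    [FrechetUrysohnSpace X] [T2Space X] {T : Set X} {b : X} (hb : b ∈ closure T) :
    ∃ S, IsClosed S ∧ b ∈ S ∧ S ⊆ insert b T ∧ ∃ᶠ y in 𝓝[T] b, y ∈ S := by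
  obtain ⟨u, huT, hu⟩ := mem_closure_iff_seq_limit.1 hb
  refine ⟨insert b (range u), hu.isCompact_insert_range.isClosed, mem_insert _ _,
    insert_subset_insert (range_subset_iff.2 huT), ?_⟩
  exact (tendsto_nhdsWithin_iff.2 ⟨hu, Eventually.of_forall huT⟩).frequently
    (Frequently.of_forall fun n => mem_insert_of_mem _ (mem_range_self n))

theorem exists_isClosed_subset_insert_frequently_nhdsLT_nhdsGT {α : Type*} [LinearOrder α]
    [TopologicalSpace α] [OrderTopology α] [DenselyOrdered α] [NoMinOrder α] [NoMaxOrder α]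
    [FrechetUrysohnSpace α] {D : Set α} (hD : Dense D) (b : α) :
    ∃ S, IsClosed S ∧ b ∈ S ∧ S ⊆ insert b D ∧ (∃ᶠ y in 𝓝[<] b, y ∈ S) ∧
      ∃ᶠ y in 𝓝[>] b, y ∈ S := by
  have mem_closure_of_isOpen : ∀ U : Set α, IsOpen U → b ∈ closure U → b ∈ closure (U ∩ D) :=
    fun U hU hb => closure_minimal (hD.open_subset_closure_inter hU) isClosed_closure hb
  obtain ⟨S, hS, hbS, hSD, hfreqS⟩ := exists_isClosed_subset_insert_frequently_mem
    (mem_closure_of_isOpen (Iio b) isOpen_Iio (by rw [closure_Iio]; exact self_mem_Iic))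
  obtain ⟨T, hT, -, hTD, hfreqT⟩ := exists_isClosed_subset_insert_frequently_mem
    (mem_closure_of_isOpen (Ioi b) isOpen_Ioi (by rw [closure_Ioi]; exact self_mem_Ici))
  refine ⟨S ∪ T, hS.union hT, Or.inl hbS,
    union_subset (hSD.trans (insert_subset_insert inter_subset_right))
      (hTD.trans (insert_subset_insert inter_subset_right)), ?_, ?_⟩
  · exact (hfreqS.filter_mono (nhdsWithin_mono b inter_subset_left)).mono fun _ => Or.inl
  · exact (hfreqT.filter_mono (nhdsWithin_mono b inter_subset_left)).mono fun _ => Or.inr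

end ApproachSet

section IsPotential

variable {X : Type*} [LinearOrder X] [TopologicalSpace X] {C : Set X} {a : ℕ → X} {g : X → ℝ≥0∞}
  {x : X}

/-- `g` is a potential of the set `C` with respect to a sequence `a` of its points: it blows up at
the other points of `C`, is finite and continuous off `C`, and can be followed from both sides
to each `a i`. -/
structure IsPotential (C : Set X) (a : ℕ → X) (g : X → ℝ≥0∞) : Prop where
  lowerSemicontinuous : LowerSemicontinuous g
  apply_le : ∀ i, g (a i) ≤ i
  eq_top : ∀ x ∈ C \ range a, g x = ⊤
  ne_top : ∀ x ∉ C, g x ≠ ⊤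
  continuousAt : ∀ x ∉ C, ContinuousAt g x
  exists_tendsto : ∀ x ∈ range a, ∃ S, Tendsto g (𝓝[S] x) (𝓝 (g x)) ∧
    (∃ᶠ y in 𝓝[<] x, y ∈ S) ∧ ∃ᶠ y in 𝓝[>] x, y ∈ S

theorem exists_isPotential {X : Type*} [LinearOrder X] [MetricSpace X] [OrderTopology X]
    [DenselyOrdered X] [NoMinOrder X] [NoMaxOrder X] {C : Set X} {a : ℕ → X} (hC : IsClosed C)
    (hD : Dense Cᶜ) (ha : ∀ i, a i ∈ C) : ∃ g, IsPotential C a g := by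
  choose S hS hmem hSC hlt hgt using
    exists_isClosed_subset_insert_frequently_nhdsLT_nhdsGT hD
  have eq_of_mem : ∀ x ∈ C, ∀ b, x ∈ S b → x = b := fun x hx b hxb =>
    (hSC b hxb).resolve_right (not_not_intro hx)
  have hS' : ∀ i, IsClosed (S (a i)) := fun i => hS (a i)
  have hne : ∀ i, (S (a i)).Nonempty := fun i => ⟨a i, hmem (a i)⟩
  refine ⟨gapPotential C fun i => S (a i), lowerSemicontinuous_gapPotential hS' hne,
    fun i => gapPotential_le_natCast (hmem (a i)),
    fun x hx => gapPotential_eq_top hS' hx.1 fun i hi => hx.2 ⟨i, (eq_of_mem x hx.1 _ hi).symm⟩,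
    fun x => gapPotential_ne_top hne hC, fun x => continuousAt_gapPotential hS' hne hC, ?_⟩
  rintro x ⟨k, rfl⟩
  refine ⟨S (a k), tendsto_gapPotential hS' hne (ha k) nhdsWithin_le_nhds ?_, hlt _, hgt _⟩
  filter_upwards [self_mem_nhdsWithin] with y hy i hi
  rwa [← eq_of_mem _ (ha k) _ hi]

namespace IsPotential

variable [OrderTopology X]

theorem tendsto_staircaseMap_of_notMem (hg : IsPotential C a g) {l : Filter X} (hl : l ≤ 𝓝 x)
    (hx : x ∉ C) : Tendsto (staircaseMap a g) l (𝓝 (staircaseMap a g x)) :=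
  tendsto_staircaseMap_of_ne_top hg.apply_le hl ((hg.continuousAt x hx).mono_left hl)
    (hg.ne_top x hx)

theorem tendsto_staircaseMap_nhdsLT (hg : IsPotential C a g) (hx : x ∉ range a) :
    Tendsto (staircaseMap a g) (𝓝[<] x) (𝓝 (staircaseMap a g x)) := by
  by_cases hxC : x ∈ C
  · exact _root_.tendsto_staircaseMap_nhdsLT hg.apply_le hg.lowerSemicontinuous
      (hg.eq_top x ⟨hxC, hx⟩)
  · exact hg.tendsto_staircaseMap_of_notMem nhdsWithin_le_nhds hxC

theorem mapClusterPt_staircaseMap (hg : IsPotential C a g) {S T : Set X}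
    (hS : Tendsto g (𝓝[S] x) (𝓝 (g x))) (hx : x ∈ range a) (hST : ∃ᶠ y in 𝓝[T] x, y ∈ S) :
    MapClusterPt (staircaseMap a g x) (𝓝[T] x) (staircaseMap a g) := by
  obtain ⟨k, rfl⟩ := hx
  exact mapClusterPt_of_frequently hST (tendsto_staircaseMap_of_ne_top hg.apply_le
    (inf_le_left.trans nhdsWithin_le_nhds) (hS.mono_left (inf_le_inf_right _ nhdsWithin_le_nhds))
    ((hg.apply_le k).trans_lt (ENNReal.natCast_lt_top k)).ne)

theorem mapClusterPt_staircaseMap_nhdsLT [DenselyOrdered X] [NoMinOrder X]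
    (hg : IsPotential C a g) (x : X) :
    MapClusterPt (staircaseMap a g x) (𝓝[<] x) (staircaseMap a g) := by
  by_cases hx : x ∈ range a
  · obtain ⟨S, hS, hlt, -⟩ := hg.exists_tendsto x hx
    exact hg.mapClusterPt_staircaseMap hS hx hlt
  · exact (hg.tendsto_staircaseMap_nhdsLT hx).mapClusterPt

theorem mapClusterPt_staircaseMap_nhdsGT [DenselyOrdered X] [NoMaxOrder X]
    (hg : IsPotential C a g) (hA : ∀ x ∈ C \ range a, ∃ᶠ y in 𝓝[>] x, y ∈ range a) (x : X) :
    MapClusterPt (staircaseMap a g x) (𝓝[>] x) (staircaseMap a g) := by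
  by_cases hx : x ∈ range a
  · obtain ⟨S, hS, -, hgt⟩ := hg.exists_tendsto x hx
    exact hg.mapClusterPt_staircaseMap hS hx hgt
  · by_cases hxC : x ∈ C
    · exact _root_.mapClusterPt_staircaseMap_nhdsGT hg.apply_le hg.lowerSemicontinuous
        (hg.eq_top x ⟨hxC, hx⟩) (hA x ⟨hxC, hx⟩)
    · exact (hg.tendsto_staircaseMap_of_notMem nhdsWithin_le_nhds hxC).mapClusterPt

end IsPotential

theorem exists_mem_range_Ioo_of_frequently_nhdsGT [OrderTopology X] {y z : X}
    (hz : z ∉ range a) (h : ∃ᶠ w in 𝓝[>] z, w ∈ range a) (hzy : z < y) (N : ℕ) :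
    ∃ i ≥ N, a i ∈ Ioo z y := by
  have hfin : IsClosed (a '' Iio N) := ((finite_Iio N).image a).isClosed
  have hev : ∀ᶠ w in 𝓝[>] z, w ∉ a '' Iio N :=
    nhdsWithin_le_nhds (hfin.isOpen_compl.mem_nhds fun hz' => hz (image_subset_range a _ hz'))
  obtain ⟨_, ⟨⟨i, rfl⟩, hi⟩, hiy⟩ := ((h.and_eventually hev).and_eventually
    (Ioo_mem_nhdsGT hzy)).exists
  exact ⟨i, not_lt.1 fun hiN => hi ⟨i, hiN, rfl⟩, hiy⟩

theorem IsPotential.not_continuousWithinAt_staircaseMap [OrderTopology X]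
    (hg : IsPotential C a g) (hA : ∀ x ∈ C \ range a, ∃ᶠ y in 𝓝[>] x, y ∈ range a)
    (hB : ∀ x ∈ C \ range a, ∃ᶠ y in 𝓝[>] x, y ∈ C \ range a)
    (hC : ∀ x ∈ C, ∃ᶠ y in 𝓝 x, y ∈ C \ range a) (hx : x ∈ C) :
    ¬ ContinuousWithinAt (staircaseMap a g) C x := by
  refine not_tendsto_staircaseMap (frequently_nhdsWithin_iff.2 (frequently_nhds_iff.2 ?_))
  intro U hxU hU
  by_cases hxa : x ∈ range a
  · obtain ⟨k, rfl⟩ := hxa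
    obtain ⟨z, hz, hzU⟩ := ((hC _ hx).and_eventually (hU.mem_nhds hxU)).exists
    obtain ⟨y, ⟨hy, hyU⟩, hzy⟩ := (((hB z hz).and_eventually
      (nhdsWithin_le_nhds (hU.mem_nhds hzU))).and_eventually self_mem_nhdsWithin).exists
    obtain ⟨i, hki, hi⟩ := exists_mem_range_Ioo_of_frequently_nhdsGT hz.2 (hA z hz) hzy k
    exact ⟨y, hyU, ⟨hg.eq_top y hy, i, hi.2,
      Or.inr ((hg.apply_le k).trans (Nat.cast_le.2 hki))⟩, hy.1⟩
  · obtain ⟨y, ⟨hy, hyU⟩, hxy⟩ := (((hB x ⟨hx, hxa⟩).and_eventually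
      (nhdsWithin_le_nhds (hU.mem_nhds hxU))).and_eventually self_mem_nhdsWithin).exists
    obtain ⟨i, -, hi⟩ := exists_mem_range_Ioo_of_frequently_nhdsGT hxa (hA x ⟨hx, hxa⟩) hxy 0
    exact ⟨y, hyU, ⟨hg.eq_top y hy, i, hi.2, Or.inl hi.1.le⟩, hy.1⟩

end IsPotential

section RightIsolated

variable {X : Type*} [LinearOrder X] [TopologicalSpace X] {C D : Set X} {x : X}

/-- The points of `C` that are isolated from the right in `C`. -/
def rightIsolated (C : Set X) : Set X := {x ∈ C | 𝓝[C ∩ Ioi x] x = ⊥}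

theorem mem_rightIsolated_iff : x ∈ rightIsolated C ↔ x ∈ C ∧ ∀ᶠ y in 𝓝[>] x, y ∉ C := by
  rw [rightIsolated, mem_ofPred_eq, inter_comm, nhdsWithin_inter', inf_principal_eq_bot]
  rfl

theorem frequently_nhdsGT_mem_of_mem_diff_rightIsolated (hx : x ∈ C \ rightIsolated C) :
    ∃ᶠ y in 𝓝[>] x, y ∈ C := fun h => hx.2 (mem_rightIsolated_iff.2 ⟨hx.1, h⟩)

variable [OrderTopology X]

theorem countable_rightIsolated [SecondCountableTopology X] (C : Set X) :
    (rightIsolated C).Countable :=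
  countable_setOfPred_isolated_right_within

theorem frequently_nhdsGT_mem_rightIsolated [CompactIccSpace X] [NoMaxOrder X] (hC : IsClosed C)
    (hD : Dense Cᶜ) (hx : x ∈ C \ rightIsolated C) : ∃ᶠ y in 𝓝[>] x, y ∈ rightIsolated C := by
  refine frequently_iff.2 fun {U} hU => ?_
  obtain ⟨v, hv, hvU⟩ := mem_nhdsGT_iff_exists_Ioo_subset.1 hU
  have hfreq := frequently_nhdsGT_mem_of_mem_diff_rightIsolated hx
  obtain ⟨q, -, hq⟩ := (hfreq.and_eventually (Ioo_mem_nhdsGT hv)).exists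
  obtain ⟨p, hp, hpC⟩ := hD.inter_open_nonempty (Ioo x v) isOpen_Ioo ⟨q, hq⟩
  obtain ⟨w, hwC, hw⟩ := (hfreq.and_eventually (Ioo_mem_nhdsGT hp.1)).exists
  obtain ⟨r, ⟨hrC, hr⟩, hmax⟩ := (isCompact_Icc.inter_left hC).exists_isGreatest
    (⟨w, hwC, hw.1.le, hw.2.le⟩ : (C ∩ Icc x p).Nonempty)
  have hxr : x < r := hw.1.trans_le (hmax ⟨hwC, hw.1.le, hw.2.le⟩)
  have hrp : r < p := hr.2.lt_of_ne fun h => hpC (h ▸ hrC)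
  refine ⟨r, hvU ⟨hxr, hrp.trans hp.2⟩, mem_rightIsolated_iff.2 ⟨hrC, ?_⟩⟩
  filter_upwards [Ioo_mem_nhdsGT hrp] with y hy hyC
  exact (hmax ⟨hyC, (hxr.trans hy.1).le, hy.2.le⟩).not_gt hy.1

theorem frequently_nhdsGT_of_forall_frequently_nhds (hx : ∃ᶠ y in 𝓝[>] x, y ∈ C)
    (h : ∀ y ∈ C, ∃ᶠ z in 𝓝 y, z ∈ D) : ∃ᶠ z in 𝓝[>] x, z ∈ D := by
  intro hev
  obtain ⟨y, hyC, hy, hxy⟩ := (hx.and_eventually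
    ((eventually_eventually_nhdsWithin.2 hev).and self_mem_nhdsWithin)).exists
  rw [isOpen_Ioi.nhdsWithin_eq hxy] at hy
  exact h y hyC hy

end RightIsolated

section Perfect

variable {X : Type*} [MetricSpace X] [CompleteSpace X] {C A : Set X} {x : X}

theorem not_countable_of_perfect (hC : Perfect C) (hne : C.Nonempty) : ¬ C.Countable := by
  obtain ⟨u, hu, -, hinj⟩ := hC.exists_nat_bool_injection hne
  intro h
  have : Countable (range u) := (h.mono hu).to_subtype
  have : Uncountable (ℕ → Bool) :=
    Cardinal.aleph0_lt_mk_iff.1 (by simp [Cardinal.aleph0_lt_continuum])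
  exact not_countable (α := ℕ → Bool) (rangeFactorization_injective.2 hinj).countable

theorem frequently_nhds_mem_diff_of_perfect (hC : Perfect C) (hA : A.Countable) (hx : x ∈ C) :
    ∃ᶠ y in 𝓝 x, y ∈ C \ A := by
  refine (closed_nhds_basis x).frequently_iff.2 ?_
  rintro U ⟨hU, hUcl⟩
  obtain ⟨hperf, hne⟩ := hC.closure_nhds_inter x hx (mem_interior_iff_mem_nhds.2 hU) isOpen_interior
  obtain ⟨y, hy, hyA⟩ := not_subset.1 fun h => not_countable_of_perfect hperf hne (hA.mono h)
  have hsub : closure (interior U ∩ C) ⊆ U ∩ C :=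
    closure_minimal (inter_subset_inter_left C interior_subset) (hUcl.inter hC.closed)
  exact ⟨y, (hsub hy).1, (hsub hy).2, hyA⟩

end Perfect

section CantorSet

theorem perfect_cantorSet : Perfect cantorSet := by
  refine ⟨isClosed_cantorSet, fun x hx => accPt_iff_frequently.2 ?_⟩
  set e := cantorSetHomeomorphNatToBool
  set b := e ⟨x, hx⟩
  have hlim : Tendsto (fun n => Function.update b n (!b n)) atTop (𝓝 b) :=
    tendsto_pi_nhds.2 fun i => tendsto_const_nhds.congr'
      ((eventually_gt_atTop i).mono fun n hn => (Function.update_of_ne hn.ne _ _).symm)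
  have hx' : e.symm b = ⟨x, hx⟩ := e.symm_apply_apply _
  have hlim' := continuous_subtype_val.continuousAt.tendsto.comp
    ((e.symm.continuous.tendsto b).comp hlim)
  rw [hx'] at hlim'
  refine hlim'.frequently (Frequently.of_forall fun n => ⟨fun h => ?_, Subtype.coe_prop _⟩)
  have hn := congr_fun (e.symm.injective ((Subtype.ext h).trans hx'.symm)) n
  simp at hn

theorem dense_compl_of_isTotallyDisconnected {X : Type*} [ConditionallyCompleteLinearOrder X]
    [TopologicalSpace X] [OrderTopology X] [DenselyOrdered X] [Nontrivial X] {C : Set X}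
    (hC : IsTotallyDisconnected C) : Dense Cᶜ := by
  refine dense_of_exists_between fun {x y} hxy => ?_
  obtain ⟨z, hz, hzC⟩ := not_subset.1 fun h : Ioo x y ⊆ C =>
    (Ioo_infinite hxy).nontrivial.not_subsingleton (hC _ h isPreconnected_Ioo)
  exact ⟨z, hzC, hz⟩

theorem dense_compl_cantorSet : Dense cantorSetᶜ :=
  dense_compl_of_isTotallyDisconnected (totallyDisconnectedSpace_subtype_iff.1
    cantorSetHomeomorphNatToBool.symm.totallyDisconnectedSpace)

end CantorSet

theorem mainTheorem5_general {C : Set ℝ} (hC : Perfect C) (hne : C.Nonempty) (hD : Dense Cᶜ) :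
    ∃ f : ℝ → NonemptyClosedSubsets ℝ,
      IsBaireOne f ∧ FSigmaMeasurable f ∧ IsDarboux f ∧
      (∀ x : C, ¬ ContinuousAt (C.domRestrict f) x) ∧
      ¬ BarelyContinuous f ∧
      HereditarilyLindelofSpace (Set.range f) ∧
      T6Space (Set.range f) := by
  have hcount := countable_rightIsolated C
  have hnhds : ∀ x ∈ C, ∃ᶠ y in 𝓝 x, y ∈ C \ rightIsolated C := fun x =>
    frequently_nhds_mem_diff_of_perfect hC hcount
  have hA : ∀ x ∈ C \ rightIsolated C, ∃ᶠ y in 𝓝[>] x, y ∈ rightIsolated C := fun x =>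
    frequently_nhdsGT_mem_rightIsolated hC.closed hD
  have hB : ∀ x ∈ C \ rightIsolated C, ∃ᶠ y in 𝓝[>] x, y ∈ C \ rightIsolated C := fun x hx =>
    frequently_nhdsGT_of_forall_frequently_nhds
      (frequently_nhdsGT_mem_of_mem_diff_rightIsolated hx) hnhds
  obtain ⟨x₀, hx₀⟩ := hne
  obtain ⟨x₁, hx₁⟩ := (hnhds x₀ hx₀).exists
  obtain ⟨a, ha⟩ := hcount.exists_eq_range (hA x₁ hx₁).exists
  have haC : ∀ i, a i ∈ C := fun i => (ha ▸ mem_range_self i : a i ∈ rightIsolated C).1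
  rw [ha] at hcount hnhds hA hB
  obtain ⟨g, hg⟩ := exists_isPotential hC.closed hD haC
  have hleft : ∀ x ∉ range a, Tendsto (staircaseMap a g) (𝓝[<] x) (𝓝 (staircaseMap a g x)) :=
    fun x => hg.tendsto_staircaseMap_nhdsLT
  have hmeas : FSigmaMeasurable (staircaseMap a g) := .of_tendsto_nhdsLT hcount hleft
  have hdisc : ∀ x : C, ¬ ContinuousAt (C.domRestrict (staircaseMap a g)) x := fun x =>
    mt (continuousWithinAt_iff_continuousAt_domRestrict _ x.2).2
      (hg.not_continuousWithinAt_staircaseMap hA hB hnhds x.2)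
  have hL := hereditarilyLindelofSpace_range_of_tendsto_nhdsLT hcount hleft
  exact ⟨staircaseMap a g,
    isBaireOne_intervalUnion fun i => lowerSemicontinuous_staircaseCoord hg.lowerSemicontinuous i,
    hmeas, hmeas.isDarboux hg.mapClusterPt_staircaseMap_nhdsLT
      (hg.mapClusterPt_staircaseMap_nhdsGT hA),
    hdisc, fun h => (h C hC.closed ⟨x₀, hx₀⟩).elim hdisc, hL,
    t6Space_of_regularSpace_of_hereditarilyLindelofSpace _⟩

theorem mainTheorem5 :
    ∃ f : ℝ → NonemptyClosedSubsets ℝ,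
      IsBaireOne f ∧ FSigmaMeasurable f ∧ IsDarboux f ∧
      (∀ x : cantorSet, ¬ ContinuousAt (cantorSet.domRestrict f) x) ∧
      ¬ BarelyContinuous f ∧
      HereditarilyLindelofSpace (Set.range f) ∧
      T6Space (Set.range f) :=
  mainTheorem5_general perfect_cantorSet ⟨0, zero_mem_cantorSet⟩ dense_compl_cantorSet
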